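/- \textbf{Definitions.} A schedule for a finite poset $P$ is a linear extension of $P$. A tuple $(a_1,\dots,a_d)$ of distinct elements of $P$ is admissible if for all $i\le j$ either $a_i\le a_j$ or $a_i,a_j$ are incomparable. A schedule hits the tuple if it orders these elements as $a_1,\dots,a_d$. A set of schedules for $P$ is a $d$-hitting family if every admissible $d$-tuple is hit by one of its members. $T^h=\{0,1\}^{\le h}$, ordered by the prefix relation, is the complete binary tree of height $h\ge 0$; it has $n=2^{h+1}-1$ nodes. A $(d,h)$-pattern consists of (up to isomorphism) a planar rooted tree $D$ whose non-leaf nodes have one or two children (two children being ordered as left and right), with at least $d$ and at most $2d-1$ nodes, at most $d-1$ of them non-leaves; a layer $\ell(c)\in\{0,\dots,h-1\}$ for each non-leaf node $c$ of $D$, strictly increasing along each root-to-leaf path; and a schedule $\pi$ for $D$ (ordered with the root as least element). (These are the shapes of the lca-closures in $T^h$ of sets of $d$ nodes.) A pattern $p$ cuts $T^h$ into pieces, each belonging to a node of $D$: starting at the root of $D$, a string $x\in T^h$ that has reached the node $c$ belongs to $c$ if $c$ is a leaf or $|x|\le\ell(c)$; otherwise it is passed on to the only child of $c$, or, if $c$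 has two children, to the left or right child according to whether the letter of $x$ following its prefix of length $\ell(c)$ is $0$ or $1$. The schedule $\alpha_p$ arranges the events $x\in T^h$ according to the order $\pi$ of the nodes of $D$ to which they belong, events belonging to the same node being arranged lexicographically (left-to-right depth-first traversal). Put $$\mathcal F_{d,h}=\{\alpha_p : p \text{ a } (d,h)\text{-pattern}\},\qquad C_d=\tfrac13\,4^{2d-1}\,(2d-1)!.$$ \textbf{Theorem.} Let $d\ge 3$ and $h\ge 0$. Then $\mathcal F_{d,h}$ is a $d$-hitting family of schedules for $T^h$, and $$|\mathcal F_{d,h}|\le C_d\,h^{d-1},$$ so for fixed $d$ its size is $O(h^{d-1})$. In terms of the number $n=2^{h+1}-1$ of nodes, $|\mathcal F_{d,h}|\le C_d\,(\log_2 n)^{d-1}$. Moreover, for every subset $B\subseteq T^h$ with the induced order (in particular for every binary tree of height at most $h$, viewed as a prefix-closed set of strings), the restrictions to $B$ of the schedules in $\mathcal F_{d,h}$ form a $d$-hitting family for $B$ with at most $C_d\,h^{d-1}$ members; so if $B$ is balanced in the sense that $h\le c\,\log_2|B|$ for a real number $c$, then this family has at most $C_d\,(c\log_2|B|)^{d-1}$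 members. -/

import Mathlib

/-! ### Schedules and hitting families -/

/-- A schedule for `P` is a linear extension of `P`: a linear order `r` on the events of `P`
that contains the order of `P`. -/
structure IsSchedule {P : Type*} [PartialOrder P] (r : P → P → Prop) : Prop where
  refl : ∀ x, r x x
  antisymm : ∀ x y, r x y → r y x → x = y
  trans : ∀ x y z, r x y → r y z → r x z
  total : ∀ x y, r x y ∨ r y x
  extends_le : ∀ x y, x ≤ y → r x y

/-- An admissible `d`-tuple: distinct events, and no later event strictly precedes an earlier
one (for `i ≤ j`, either `a i ≤ a j` or the two events are incomparable). -/
def Admissible {P : Type*} [PartialOrder P] {d : ℕ} (a : Fin d → P) : Prop :=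
  Function.Injective a ∧ ∀ i j, i ≤ j → a i ≤ a j ∨ (¬ a i ≤ a j ∧ ¬ a j ≤ a i)

/-- The schedule `r` hits the tuple `a`: restricted to the events of `a`, it is the sequence
`a 0, a 1, …`. -/
def Hits {P : Type*} {d : ℕ} (r : P → P → Prop) (a : Fin d → P) : Prop :=
  ∀ i j, r (a i) (a j) ↔ i ≤ j

/-- `F` is a `d`-hitting family of schedules for `P`. -/
def IsHittingFamily {P : Type*} [PartialOrder P] (d : ℕ) (F : Set (P → P → Prop)) : Prop :=
  (∀ r ∈ F, IsSchedule r) ∧ ∀ a : Fin d → P, Admissible a → ∃ r ∈ F, Hits r a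

/-! ### The complete binary tree -/

/-- The complete binary tree of height `h`: binary strings of length at most `h`. -/
def CBTree (h : ℕ) : Type := {w : List Bool // w.length ≤ h}

/-- The tree order: `x ≤ y` iff `x` is a prefix of `y`. -/
instance CBTree.instPartialOrder (h : ℕ) : PartialOrder (CBTree h) where
  le x y := x.1 <+: y.1
  le_refl x := List.prefix_refl x.1
  le_trans _ _ _ hxy hyz := hxy.trans hyz
  le_antisymm _ _ hxy hyx := Subtype.ext (hxy.eq_of_length_le hyx.length_le)

/-! ### Patterns -/

/-- Planar trees in which every non-leaf node has one or two children (the two children of a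
binary node being ordered, left and right) and carries a number, its layer. -/
inductive LayeredTree : Type where
  | leaf : LayeredTree
  | unary (layer : ℕ) (t : LayeredTree) : LayeredTree
  | binary (layer : ℕ) (t₀ t₁ : LayeredTree) : LayeredTree

namespace LayeredTree

/-- The nodes of a tree: its root, and the nodes of the subtrees at the children of the root. -/
inductive Node : LayeredTree → Type where
  | root (t : LayeredTree) : Node t
  | child {ℓ : ℕ} {t : LayeredTree} (u : Node t) : Node (unary ℓ t)
  | left {ℓ : ℕ} {t₀ t₁ : LayeredTree} (u : Node t₀) : Node (binary ℓ t₀ t₁)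
  | right {ℓ : ℕ} {t₀ t₁ : LayeredTree} (u : Node t₁) : Node (binary ℓ t₀ t₁)

/-- The tree order on the nodes, the root being the least element: nodes in the two different
subtrees of a binary node are incomparable. -/
inductive Node.Le : {t : LayeredTree} → Node t → Node t → Prop where
  | root {t : LayeredTree} (u : Node t) : Node.Le (Node.root t) u
  | child {ℓ : ℕ} {t : LayeredTree} {u v : Node t} (huv : Node.Le u v) :
      Node.Le (Node.child (ℓ := ℓ) u) (Node.child v)
  | left {ℓ : ℕ} {t₀ t₁ : LayeredTree} {u v : Node t₀} (huv : Node.Le u v) :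
      Node.Le (Node.left (ℓ := ℓ) (t₁ := t₁) u) (Node.left v)
  | right {ℓ : ℕ} {t₀ t₁ : LayeredTree} {u v : Node t₁} (huv : Node.Le u v) :
      Node.Le (Node.right (ℓ := ℓ) (t₀ := t₀) u) (Node.right v)

theorem Node.Le.refl {t : LayeredTree} (u : Node t) : Node.Le u u := by
  induction u with
  | root t => exact .root _
  | child u ih => exact .child ih
  | left u ih => exact .left ih
  | right u ih => exact .right ih

theorem Node.Le.trans {t : LayeredTree} {u v w : Node t} (huv : Node.Le u v)
    (hvw : Node.Le v w) : Node.Le u w := by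
  induction huv with
  | root u => exact .root _
  | child _ ih => cases hvw with | child h => exact .child (ih h)
  | left _ ih => cases hvw with | left h => exact .left (ih h)
  | right _ ih => cases hvw with | right h => exact .right (ih h)

theorem Node.Le.antisymm {t : LayeredTree} {u v : Node t} (huv : Node.Le u v)
    (hvu : Node.Le v u) : u = v := by
  induction huv with
  | root u => cases hvu; rfl
  | child _ ih => cases hvu with | child h => rw [ih h]
  | left _ ih => cases hvu with | left h => rw [ih h]
  | right _ ih => cases hvu with | right h => rw [ih h]

instance Node.instPartialOrder (t : LayeredTree) : PartialOrder (Node t) where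
  le := Node.Le
  le_refl := Node.Le.refl
  le_trans _ _ _ huv hvw := huv.trans hvw
  le_antisymm _ _ huv hvu := huv.antisymm hvu

/-- The number of nodes. -/
def numNodes : LayeredTree → ℕ
  | leaf => 1
  | unary _ t => t.numNodes + 1
  | binary _ t₀ t₁ => t₀.numNodes + t₁.numNodes + 1

/-- The number of non-leaf nodes. -/
def numInner : LayeredTree → ℕ
  | leaf => 0
  | unary _ t => t.numInner + 1
  | binary _ t₀ t₁ => t₀.numInner + t₁.numInner + 1

/-- All layers lie in `{k, …, h - 1}`, and they strictly increase from each non-leaf node to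
its non-leaf descendants. -/
def LayersIn (h : ℕ) : ℕ → LayeredTree → Prop
  | _, leaf => True
  | k, unary ℓ t => k ≤ ℓ ∧ ℓ < h ∧ LayersIn h (ℓ + 1) t
  | k, binary ℓ t₀ t₁ => k ≤ ℓ ∧ ℓ < h ∧ LayersIn h (ℓ + 1) t₀ ∧ LayersIn h (ℓ + 1) t₁

/-- The node `c` of the tree to whose piece the binary string `x` belongs. The pieces of the
root consist of the strings of length at most the layer of the root; longer strings are
passed on to the only child, or, at a binary node of layer `ℓ`, to the left or right child
according to the letter `x[ℓ]` that follows the prefix of length `ℓ`. The pieces of a leaf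
stretch down to the bottom. -/
def cell : (t : LayeredTree) → List Bool → Node t
  | leaf, _ => .root leaf
  | unary ℓ t, x => if x.length ≤ ℓ then .root (unary ℓ t) else .child (t.cell x)
  | binary ℓ t₀ t₁, x =>
    if x.length ≤ ℓ then .root (binary ℓ t₀ t₁)
    else if x[ℓ]? = some true then .right (t₁.cell x)
    else .left (t₀.cell x)

end LayeredTree

/-- A pattern for `d`-tuples in the complete binary tree of height `h`: a planar tree of the
shape of an lca-closure of a `d`-element set, with at least `d` and at most `2 * d - 1` nodes,
at most `d - 1` of which are not leaves; a layer in `{0, …, h - 1}` for every non-leaf node,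
strictly increasing away from the root; and a schedule for the nodes of the tree. -/
structure Pattern (d h : ℕ) where
  tree : LayeredTree
  le_numNodes : d ≤ tree.numNodes
  numNodes_le : tree.numNodes ≤ 2 * d - 1
  numInner_le : tree.numInner ≤ d - 1
  layersIn : tree.LayersIn h 0
  order : tree.Node → tree.Node → Prop
  isSchedule : IsSchedule order

/-- The schedule of a pattern: the pieces of the complete binary tree are arranged as the
pattern orders the nodes to which they belong, and the events of the pieces of one node are
arranged lexicographically (left-to-right depth-first traversal; `≤` on `List Bool` is the
lexicographic order with `false < true`). -/
def Pattern.schedule {d h : ℕ} (p : Pattern d h) (x y : CBTree h) : Prop :=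
  (p.tree.cell x.1 ≠ p.tree.cell y.1 ∧ p.order (p.tree.cell x.1) (p.tree.cell y.1)) ∨
    (p.tree.cell x.1 = p.tree.cell y.1 ∧ x.1 ≤ y.1)

/-- The family of the schedules of all patterns. -/
def patternFamily (d h : ℕ) : Set (CBTree h → CBTree h → Prop) :=
  Set.range (fun p : Pattern d h => p.schedule)

/-- The restrictions to the subset `B` of the schedules in a family `F`. -/
def restrictFamily {P : Type*} (F : Set (P → P → Prop)) (B : Set P) : Set (B → B → Prop) :=
  (fun r (x y : B) => r x.1 y.1) '' F

/-- The factor in the size of the family that depends only on `d`. -/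
noncomputable def patternConst (d : ℕ) : ℝ :=
  (4 : ℝ) ^ (2 * d - 1) / 3 * ((2 * d - 1).factorial : ℝ)

namespace LayeredTree

/-! ### Nodes -/

/-! Let `S` be the set of the `d` strings of an admissible tuple. Closing `S` under longest common
prefixes gives a layered tree whose cells reflect the prefix order on `S`: if `x` and `y` are in `S`
and the cell of `x` lies below that of `y`, then `x` is a prefix of `y` (`exists_separates`). By
admissibility no later cell of the tuple lies below an earlier one, so some schedule of the small
tree lists the cells in the order of the tuple (`exists_isSchedule_hits`), and the resulting pattern
schedule hits the tuple. Pattern schedules extend the prefix order because `cell` is monotone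
(`cell_mono`) and the lexicographic order extends the prefix order.

For the size, the only data depending on `h` are the layers of the non-leaf nodes, at most `d - 1`
of them, which gives `h ^ (d - 1)`. The shape is encoded by its preorder word of arities, at most `2
* d - 1` letters from a three-letter alphabet, and each tree has at most `(2 * d - 1)!` schedules.
Finally `3 ^ N ≤ 4 ^ N / 3` for `N = 2 * d - 1 ≥ 5`. -/

theorem Node.root_le {t : LayeredTree} (u : Node t) : Node.root t ≤ u := Node.Le.root u

@[simp] theorem Node.child_le_child {ℓ : ℕ} {t : LayeredTree} {u v : Node t} :
    (Node.child (ℓ := ℓ) u) ≤ Node.child v ↔ u ≤ v :=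
  ⟨fun h => by cases h with | child h => exact h, Node.Le.child⟩

@[simp] theorem Node.left_le_left {ℓ : ℕ} {t₀ t₁ : LayeredTree} {u v : Node t₀} :
    (Node.left (ℓ := ℓ) (t₁ := t₁) u) ≤ Node.left v ↔ u ≤ v :=
  ⟨fun h => by cases h with | left h => exact h, Node.Le.left⟩

@[simp] theorem Node.right_le_right {ℓ : ℕ} {t₀ t₁ : LayeredTree} {u v : Node t₁} :
    (Node.right (ℓ := ℓ) (t₀ := t₀) u) ≤ Node.right v ↔ u ≤ v :=
  ⟨fun h => by cases h with | right h => exact h, Node.Le.right⟩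

@[simp] theorem Node.not_child_le_root {ℓ : ℕ} {t : LayeredTree} {u : Node t} :
    ¬ Node.child (ℓ := ℓ) u ≤ Node.root _ := fun h => by cases h

@[simp] theorem Node.not_left_le_root {ℓ : ℕ} {t₀ t₁ : LayeredTree} {u : Node t₀} :
    ¬ Node.left (ℓ := ℓ) (t₁ := t₁) u ≤ Node.root _ := fun h => by cases h

@[simp] theorem Node.not_right_le_root {ℓ : ℕ} {t₀ t₁ : LayeredTree} {u : Node t₁} :
    ¬ Node.right (ℓ := ℓ) (t₀ := t₀) u ≤ Node.root _ := fun h => by cases h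

@[simp] theorem Node.not_left_le_right {ℓ : ℕ} {t₀ t₁ : LayeredTree} {u : Node t₀} {v : Node t₁} :
    ¬ Node.left (ℓ := ℓ) u ≤ Node.right v := fun h => by cases h

@[simp] theorem Node.not_right_le_left {ℓ : ℕ} {t₀ t₁ : LayeredTree} {u : Node t₁} {v : Node t₀} :
    ¬ Node.right (ℓ := ℓ) u ≤ Node.left v := fun h => by cases h

/-- The nodes of a unary tree are its root and the nodes of the subtree. -/
def nodeUnaryEquiv (ℓ : ℕ) (t : LayeredTree) : Node (unary ℓ t) ≃ Option (Node t) where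
  toFun
    | .root _ => none
    | .child u => some u
  invFun
    | none => .root _
    | some u => .child u
  left_inv u := by cases u <;> rfl
  right_inv u := by cases u <;> rfl

/-- The nodes of a binary tree are its root and the nodes of the two subtrees. -/
def nodeBinaryEquiv (ℓ : ℕ) (t₀ t₁ : LayeredTree) :
    Node (binary ℓ t₀ t₁) ≃ Option (Node t₀ ⊕ Node t₁) where
  toFun
    | .root _ => none
    | .left u => some (.inl u)
    | .right u => some (.inr u)
  invFun
    | none => .root _
    | some (.inl u) => .left u
    | some (.inr u) => .right u
  left_inv u := by cases u <;> rfl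
  right_inv u := by rcases u with _ | _ | _ <;> rfl

instance finite_node (t : LayeredTree) : Finite (Node t) := by
  induction t with
  | leaf => exact Finite.of_surjective (fun _ : Unit => Node.root leaf) fun u =>
      ⟨(), by cases u; rfl⟩
  | unary ℓ t ih => exact Finite.of_equiv _ (nodeUnaryEquiv ℓ t).symm
  | binary ℓ t₀ t₁ ih₀ ih₁ => exact Finite.of_equiv _ (nodeBinaryEquiv ℓ t₀ t₁).symm

theorem card_node (t : LayeredTree) : Nat.card (Node t) = t.numNodes := by
  induction t with
  | leaf =>
    rw [numNodes, Nat.card_eq_one_iff_exists]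
    exact ⟨.root leaf, fun u => by cases u; rfl⟩
  | unary ℓ t ih => rw [Nat.card_congr (nodeUnaryEquiv ℓ t), Finite.card_option, ih, numNodes]
  | binary ℓ t₀ t₁ ih₀ ih₁ =>
    rw [Nat.card_congr (nodeBinaryEquiv ℓ t₀ t₁), Finite.card_option, Nat.card_sum, ih₀, ih₁,
      numNodes]

/-! ### Cells -/

/-- A prefix longer than `ℓ` already contains the letter at position `ℓ`, so both strings descend
along the same branch until the shorter one stops. -/
theorem cell_mono (t : LayeredTree) {x y : List Bool} (hxy : x <+: y) : t.cell x ≤ t.cell y := by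
  induction t with
  | leaf => exact le_rfl
  | unary ℓ t ih =>
    simp only [cell]
    have := hxy.length_le
    split_ifs
    · exact le_rfl
    · exact Node.root_le _
    · omega
    · simpa using ih
  | binary ℓ t₀ t₁ ih₀ ih₁ =>
    simp only [cell]
    have := hxy.length_le
    by_cases hx : x.length ≤ ℓ
    · rw [if_pos hx]; exact Node.root_le _
    · have hy : ¬ y.length ≤ ℓ := by omega
      have hl : y[ℓ]? = x[ℓ]? := by
        obtain ⟨z, rfl⟩ := hxy
        exact List.getElem?_append_left (by omega)
      rw [if_neg hx, if_neg hy, hl]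
      split_ifs
      · simpa using ih₁
      · simpa using ih₀

theorem LayersIn.mono {h k k' : ℕ} (hk : k ≤ k') {t : LayeredTree} (ht : LayersIn h k' t) :
    LayersIn h k t := by
  cases t with
  | leaf => trivial
  | unary ℓ t => exact ⟨hk.trans ht.1, ht.2⟩
  | binary ℓ t₀ t₁ => exact ⟨hk.trans ht.1, ht.2⟩

/-- The tree `t`, with layers from `k` on, has the shape of the lca-closure of `S`, and its cells
compare the elements of `S` as the prefix order does. -/
structure Separates (h k : ℕ) (S : Finset (List Bool)) (t : LayeredTree) : Prop where
  layersIn : LayersIn h k t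
  numInner_lt : t.numInner + 1 ≤ S.card
  card_le : S.card ≤ t.numNodes
  numNodes_lt : t.numNodes + 1 ≤ 2 * S.card
  prefix_of_cell_le : ∀ x ∈ S, ∀ y ∈ S, t.cell x ≤ t.cell y → x <+: y

/-- Induction on `n`, a bound for the depth left below the common prefix `w`. The strings other than
`w` are split by the letter following `w`. A node of layer `w.length` is created only if both
classes are nonempty, or if `w` itself is in `S` and one class is nonempty. -/
theorem exists_separates (h n : ℕ) : ∀ (w : List Bool) (S : Finset (List Bool)),
    h ≤ w.length + n → S.Nonempty → (∀ x ∈ S, w <+: x ∧ x.length ≤ h) →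
      ∃ t, Separates h w.length S t := by
  induction n with
  | zero =>
    intro w S hw hS hSw
    have hSe : S = {w} := Finset.eq_singleton_iff_nonempty_unique_mem.2 ⟨hS, fun x hx =>
      ((hSw x hx).1.eq_of_length_le ((hSw x hx).2.trans hw)).symm⟩
    subst hSe
    exact ⟨leaf, trivial, by simp [numInner], by simp [numNodes], by simp [numNodes], by simp⟩
  | succ n ih =>
    intro w S hw hS hSw
    set S₀ := S.filter fun x => x[w.length]? = some false with hS₀
    set S₁ := S.filter fun x => x[w.length]? = some true with hS₁
    have hext : ∀ b, ∀ x ∈ S, x[w.length]? = some b → (w ++ [b]) <+: x := by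
      intro b x hx hb
      obtain ⟨z, rfl⟩ := (hSw x hx).1
      cases z with
      | nil => simp at hb
      | cons c z => simp at hb; subst hb; exact ⟨z, by simp⟩
    have hlen : ∀ x ∈ S, x ≠ w → w.length < x.length := by
      intro x hx hne
      by_contra hlt
      exact hne ((hSw x hx).1.eq_of_length_le (by omega)).symm
    have hcov : ∀ x ∈ S, x ≠ w → x ∈ S₀ ∨ x ∈ S₁ := by
      intro x hx hne
      have := hlen x hx hne
      rw [hS₀, hS₁, Finset.mem_filter, Finset.mem_filter, List.getElem?_eq_getElem this]
      cases x[w.length] <;> simp [hx]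
    have hlt₀ : ∀ x ∈ S₀, ¬ x.length ≤ w.length := by
      intro x hx hle
      have := (Finset.mem_filter.1 hx).2
      rw [List.getElem?_eq_none hle] at this
      simp at this
    have hlt₁ : ∀ x ∈ S₁, ¬ x.length ≤ w.length := by
      intro x hx hle
      have := (Finset.mem_filter.1 hx).2
      rw [List.getElem?_eq_none hle] at this
      simp at this
    have hw₀ : w ∉ S₀ := fun hx => hlt₀ w hx le_rfl
    have hw₁ : w ∉ S₁ := fun hx => hlt₁ w hx le_rfl
    have hdisj : Disjoint S₀ S₁ := by
      rw [Finset.disjoint_left]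
      intro x hx hx'
      have h0 := (Finset.mem_filter.1 hx).2
      rw [(Finset.mem_filter.1 hx').2] at h0
      simp at h0
    have ih₀ : S₀.Nonempty → ∃ t, Separates h (w.length + 1) S₀ t := fun hne => by
      simpa using ih (w ++ [false]) S₀ (by simp; omega) hne fun x hx =>
        have hx' := Finset.mem_filter.1 hx
        ⟨hext _ x hx'.1 hx'.2, (hSw x hx'.1).2⟩
    have ih₁ : S₁.Nonempty → ∃ t, Separates h (w.length + 1) S₁ t := fun hne => by
      simpa using ih (w ++ [true]) S₁ (by simp; omega) hne fun x hx =>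
        have hx' := Finset.mem_filter.1 hx
        ⟨hext _ x hx'.1 hx'.2, (hSw x hx'.1).2⟩
    have hh : (S₀ ∪ S₁).Nonempty → w.length < h := by
      rintro ⟨x, hx⟩
      rcases Finset.mem_union.1 hx with hx | hx
      · have := hlt₀ x hx; have := (hSw x (Finset.mem_filter.1 hx).1).2; omega
      · have := hlt₁ x hx; have := (hSw x (Finset.mem_filter.1 hx).1).2; omega
    -- adding the common prefix `w` above a tree that separates the longer strings
    have hun : ∀ S' t, S'.Nonempty → w ∉ S' → (∀ x ∈ S', x ∈ S₀ ∨ x ∈ S₁) →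
        (∀ x ∈ S, x = w ∨ x ∈ S') → S' ⊆ S →
        Separates h (w.length + 1) S' t → ∃ t, Separates h w.length S t := by
      intro S' t hne hwS' hsub hcase hS'S ht
      by_cases hwS : w ∈ S
      · have hSe : S = insert w S' := by
          ext x
          rw [Finset.mem_insert]
          exact ⟨hcase x, by rintro (rfl | hx); exacts [hwS, hS'S hx]⟩
        have hcard : S.card = S'.card + 1 := by rw [hSe, Finset.card_insert_of_notMem hwS']
        have := ht.numInner_lt; have := ht.card_le; have := ht.numNodes_lt
        have hlong : ∀ x ∈ S', ¬ x.length ≤ w.length := fun x hx =>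
          (hsub x hx).elim (hlt₀ x) (hlt₁ x)
        refine ⟨unary w.length t, ⟨le_rfl, hh (hne.mono fun x hx =>
          Finset.mem_union.2 (hsub x hx)), ht.layersIn⟩, by simp only [numInner]; omega,
          by simp only [numNodes]; omega, by simp only [numNodes]; omega, ?_⟩
        intro x hx y hy hxy
        rcases hcase x hx with rfl | hx'
        · exact (hSw y hy).1
        rcases hcase y hy with rfl | hy'
        · simp [cell, hlong x hx'] at hxy
        · simp only [cell, hlong x hx', hlong y hy', if_false, Node.child_le_child] at hxy
          exact ht.prefix_of_cell_le x hx' y hy' hxy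
      -- Here `w` neither belongs to `S` nor is a branching point, so it needs no node and the tree
      -- of `S'` serves unchanged.
      · have hSe : S = S' := Finset.Subset.antisymm
          (fun x hx => (hcase x hx).resolve_left fun e => hwS (e ▸ hx)) hS'S
        exact ⟨t, ht.layersIn.mono (Nat.le_succ _), hSe ▸ ht.numInner_lt, hSe ▸ ht.card_le,
          hSe ▸ ht.numNodes_lt, hSe ▸ ht.prefix_of_cell_le⟩
    rcases S₀.eq_empty_or_nonempty with he₀ | hne₀ <;>
      rcases S₁.eq_empty_or_nonempty with he₁ | hne₁
    · have hSe : S = {w} := Finset.eq_singleton_iff_nonempty_unique_mem.2 ⟨hS, fun x hx => by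
        by_contra hne
        simpa [he₀, he₁] using hcov x hx hne⟩
      rw [hSe]
      exact ⟨leaf, trivial, by simp [numInner], by simp [numNodes], by simp [numNodes], by simp⟩
    · obtain ⟨t, ht⟩ := ih₁ hne₁
      refine hun S₁ t hne₁ hw₁ (fun x hx => .inr hx) (fun x hx => ?_) (Finset.filter_subset _ _) ht
      by_cases hxw : x = w
      · exact .inl hxw
      · simpa [he₀, hxw] using hcov x hx hxw
    · obtain ⟨t, ht⟩ := ih₀ hne₀
      refine hun S₀ t hne₀ hw₀ (fun x hx => .inl hx) (fun x hx => ?_) (Finset.filter_subset _ _) ht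
      by_cases hxw : x = w
      · exact .inl hxw
      · simpa [he₁, hxw] using hcov x hx hxw
    · obtain ⟨t₀, ht₀⟩ := ih₀ hne₀
      obtain ⟨t₁, ht₁⟩ := ih₁ hne₁
      have hsub : S₀ ∪ S₁ ⊆ S :=
        Finset.union_subset (Finset.filter_subset _ _) (Finset.filter_subset _ _)
      -- At a branching point `w` may or may not belong to `S`. The lower bound on `S.card` gives
      -- the upper bounds on the node counts, and the upper bound on `S.card` leaves room for one
      -- element at the new root.
      have hle : S₀.card + S₁.card ≤ S.card := by
        rw [← Finset.card_union_of_disjoint hdisj]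
        exact Finset.card_le_card hsub
      have hge : S.card ≤ S₀.card + S₁.card + 1 := by
        rw [← Finset.card_union_of_disjoint hdisj]
        refine (Finset.card_le_card fun x hx => ?_).trans (Finset.card_insert_le w _)
        rw [Finset.mem_insert, Finset.mem_union]
        by_cases hxw : x = w
        · exact .inl hxw
        · exact .inr (hcov x hx hxw)
      have := ht₀.numInner_lt; have := ht₀.card_le; have := ht₀.numNodes_lt
      have := ht₁.numInner_lt; have := ht₁.card_le; have := ht₁.numNodes_lt
      have hcell₀ : ∀ x ∈ S₀, (binary w.length t₀ t₁).cell x = .left (t₀.cell x) := fun x hx => by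
        simp [cell, hlt₀ x hx, (Finset.mem_filter.1 hx).2]
      have hcell₁ : ∀ x ∈ S₁, (binary w.length t₀ t₁).cell x = .right (t₁.cell x) := fun x hx => by
        simp [cell, hlt₁ x hx, (Finset.mem_filter.1 hx).2]
      refine ⟨binary w.length t₀ t₁, ⟨le_rfl, hh (hne₀.mono Finset.subset_union_left),
        ht₀.layersIn, ht₁.layersIn⟩, by simp only [numInner]; omega,
        by simp only [numNodes]; omega, by simp only [numNodes]; omega, ?_⟩
      intro x hx y hy hxy
      by_cases hxw : x = w
      · rw [hxw]; exact (hSw y hy).1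
      by_cases hyw : y = w
      · subst hyw
        have hroot : (binary y.length t₀ t₁).cell y = .root _ := by simp [cell]
        rcases hcov x hx hxw with hx' | hx'
        · simp [hroot, hcell₀ x hx'] at hxy
        · simp [hroot, hcell₁ x hx'] at hxy
      rcases hcov x hx hxw with hx' | hx' <;> rcases hcov y hy hyw with hy' | hy'
      · rw [hcell₀ x hx', hcell₀ y hy', Node.left_le_left] at hxy
        exact ht₀.prefix_of_cell_le x hx' y hy' hxy
      · simp [hcell₀ x hx', hcell₁ y hy'] at hxy
      · simp [hcell₁ x hx', hcell₀ y hy'] at hxy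
      · rw [hcell₁ x hx', hcell₁ y hy', Node.right_le_right] at hxy
        exact ht₁.prefix_of_cell_le x hx' y hy' hxy

/-! ### Counting layered trees -/

/-- The numbers of children of the nodes, in preorder. -/
def arities : LayeredTree → List (Fin 3)
  | leaf => [0]
  | unary _ t => 1 :: t.arities
  | binary _ t₀ t₁ => 2 :: (t₀.arities ++ t₁.arities)

/-- The layers of the non-leaf nodes, in preorder. -/
def layers : LayeredTree → List ℕ
  | leaf => []
  | unary ℓ t => ℓ :: t.layers
  | binary ℓ t₀ t₁ => ℓ :: (t₀.layers ++ t₁.layers)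

theorem length_arities (t : LayeredTree) : t.arities.length = t.numNodes := by
  induction t <;> simp_all [arities, numNodes]

theorem length_layers (t : LayeredTree) : t.layers.length = t.numInner := by
  induction t <;> simp_all [layers, numInner]

theorem LayersIn.lt_of_mem_layers {h : ℕ} {t : LayeredTree} : ∀ {k : ℕ}, LayersIn h k t →
    ∀ ℓ ∈ t.layers, ℓ < h := by
  induction t with
  | leaf => simp [layers]
  | unary ℓ t ih =>
    intro k ht m hm
    rcases List.mem_cons.1 hm with rfl | hm
    exacts [ht.2.1, ih ht.2.2 m hm]
  | binary ℓ t₀ t₁ ih₀ ih₁ =>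
    intro k ht m hm
    rcases List.mem_cons.1 hm with rfl | hm
    · exact ht.2.1
    rcases List.mem_append.1 hm with hm | hm
    exacts [ih₀ ht.2.2.1 m hm, ih₁ ht.2.2.2 m hm]

/-- A layered tree can be read off from any extensions of its two preorder words. -/
theorem eq_of_append_eq (t : LayeredTree) : ∀ {t' : LayeredTree} {r r' : List (Fin 3)}
    {s s' : List ℕ}, t.arities ++ r = t'.arities ++ r' → t.layers ++ s = t'.layers ++ s' →
      t = t' ∧ r = r' ∧ s = s' := by
  induction t with
  | leaf =>
    intro t' r r' s s' hr hs
    cases t' <;> simp_all [arities, layers]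
  | unary ℓ t ih =>
    intro t' r r' s s' hr hs
    cases t' with
    | leaf => simp [arities] at hr
    | binary => simp [arities] at hr
    | unary ℓ' t' =>
      simp only [arities, layers, List.cons_append, List.cons.injEq, true_and] at hr hs
      obtain ⟨rfl, hr', hs'⟩ := ih hr hs.2
      exact ⟨by rw [hs.1], hr', hs'⟩
  | binary ℓ t₀ t₁ ih₀ ih₁ =>
    intro t' r r' s s' hr hs
    cases t' with
    | leaf => simp [arities] at hr
    | unary => simp [arities] at hr
    | binary ℓ' t₀' t₁' =>
      simp only [arities, layers, List.cons_append, List.cons.injEq, true_and,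
        List.append_assoc] at hr hs
      obtain ⟨rfl, hr', hs'⟩ := ih₀ hr hs.2
      obtain ⟨rfl, hr'', hs''⟩ := ih₁ hr' hs'
      exact ⟨by rw [hs.1], hr'', hs''⟩

/-- The layered trees with at most `N` nodes, at most `m` non-leaf nodes, and layers below `h`. -/
def bounded (N m h : ℕ) : Set LayeredTree :=
  {t | t.numNodes ≤ N ∧ t.numInner ≤ m ∧ LayersIn h 0 t}

/-- The two preorder words, padded with zeros to lengths `N` and `m`, determine the tree: by
`eq_of_append_eq` the padding does not affect decoding. Positivity of `h` makes `0` a legal layer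
for padding. -/
theorem finite_bounded_and_ncard_le (N m h : ℕ) (hh : 0 < h) :
    (bounded N m h).Finite ∧ (bounded N m h).ncard ≤ 3 ^ N * h ^ m := by
  let f : bounded N m h → (Fin N → Fin 3) × (Fin m → Fin h) := fun t =>
    (fun i => t.1.arities.getD i 0, fun i => ⟨t.1.layers.getD i 0, by
      rw [List.getD_eq_getElem?_getD]
      rcases lt_or_ge i.1 t.1.layers.length with hi | hi
      · rw [List.getElem?_eq_getElem hi]
        exact t.2.2.2.lt_of_mem_layers _ (List.getElem_mem hi)
      · rw [List.getElem?_eq_none hi]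
        exact hh⟩)
  have hpad : ∀ {α : Type} (l l' : List α) (a : α) (n : ℕ), l.length ≤ n → l'.length ≤ n →
      (∀ i < n, l.getD i a = l'.getD i a) →
      l ++ List.replicate (n - l.length) a = l' ++ List.replicate (n - l'.length) a := by
    intro α l l' a n hl hl' hi
    refine List.ext_getElem (by simp; omega) fun i h₁ h₂ => ?_
    have := hi i (by simp at h₁; omega)
    simp only [List.getD_eq_getElem?_getD] at this
    rw [List.getElem_append, List.getElem_append]
    split_ifs <;> simp_all
  have hf : Function.Injective f := by
    intro t t' hft
    have h₁ := congrArg Prod.fst hft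
    have h₂ := congrArg Prod.snd hft
    refine Subtype.ext (eq_of_append_eq t.1
      (hpad t.1.arities t'.1.arities 0 N ?_ ?_ fun i hi => congrFun h₁ ⟨i, hi⟩)
      (hpad t.1.layers t'.1.layers 0 m ?_ ?_ fun i hi =>
        congrArg Fin.val (congrFun h₂ ⟨i, hi⟩))).1
    · rw [length_arities]; exact t.2.1
    · rw [length_arities]; exact t'.2.1
    · rw [length_layers]; exact t.2.2.1
    · rw [length_layers]; exact t'.2.2.1
  refine ⟨Finite.of_injective f hf, ?_⟩
  have := Nat.card_le_card_of_injective f hf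
  simpa [Nat.card_coe_set_eq] using this

end LayeredTree

/-! ### Schedules -/

theorem exists_equiv_fin_le_iff (P : Type*) [LinearOrder P] [Finite P] :
    ∃ e : P ≃ Fin (Nat.card P), ∀ x y, e x ≤ e y ↔ x ≤ y := by
  have := Fintype.ofFinite P
  let e := Fintype.orderIsoFinOfCardEq P Nat.card_eq_fintype_card.symm
  exact ⟨e.symm.toEquiv, fun x y => e.symm.le_iff_le⟩

/-- A schedule is determined by its ranking of the elements, so there are at most as many schedules
as bijections onto `Fin (Nat.card P)`. -/
theorem setOf_isSchedule_subset {P : Type*} [PartialOrder P] [Finite P] :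
    {r : P → P → Prop | IsSchedule r} ⊆
      Set.range fun (e : P ≃ Fin (Nat.card P)) x y => e x ≤ e y := by
  intro r hr
  let L : LinearOrder P :=
    { le := r
      lt := fun x y => r x y ∧ ¬ r y x
      lt_iff_le_not_ge := fun _ _ => Iff.rfl
      le_refl := hr.refl
      le_trans := hr.trans
      le_antisymm := hr.antisymm
      le_total := hr.total
      toDecidableLE := Classical.decRel _ }
  obtain ⟨e, he⟩ := @exists_equiv_fin_le_iff P L _
  exact ⟨e, funext fun x => funext fun y => propext (he x y)⟩

theorem finite_setOf_isSchedule (P : Type*) [PartialOrder P] [Finite P] :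
    {r : P → P → Prop | IsSchedule r}.Finite :=
  (Set.finite_range _).subset setOf_isSchedule_subset

theorem ncard_setOf_isSchedule_le (P : Type*) [PartialOrder P] [Finite P] :
    {r : P → P → Prop | IsSchedule r}.ncard ≤ (Nat.card P).factorial := by
  classical
  have := Fintype.ofFinite P
  refine (Set.ncard_le_ncard setOf_isSchedule_subset (Set.finite_range _)).trans ?_
  rw [← Set.image_univ]
  refine (Set.ncard_image_le Set.finite_univ).trans ?_
  rw [Set.ncard_univ, Nat.card_eq_fintype_card,
    Fintype.card_equiv (Fintype.equivFinOfCardEq Nat.card_eq_fintype_card.symm),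
    Nat.card_eq_fintype_card]

/-- A tuple none of whose later members is below an earlier one is hit by a schedule. -/
theorem exists_isSchedule_hits {P : Type*} [PartialOrder P] {d : ℕ} (A : Fin d → P)
    (hA : ∀ i j, A i ≤ A j → i ≤ j) : ∃ r, IsSchedule r ∧ Hits r A := by
  -- One jump from `A i` to `A j` with `i ≤ j` suffices for transitivity: between two jumps `A j ≤ A
  -- k`, so `j ≤ k` by `hA` and they merge into one. Likewise, `hA` makes all jumps in a cycle
  -- trivial, whence antisymmetry. A linear extension of `R` is the schedule sought.
  let R : P → P → Prop := fun u v => u ≤ v ∨ ∃ i j, i ≤ j ∧ u ≤ A i ∧ A j ≤ v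
  have hR : IsPartialOrder P R :=
    { refl := fun u => .inl le_rfl
      trans := by
        rintro u v w (huv | ⟨i, j, hij, hui, hjv⟩) (hvw | ⟨k, l, hkl, hvk, hlw⟩)
        · exact .inl (huv.trans hvw)
        · exact .inr ⟨k, l, hkl, huv.trans hvk, hlw⟩
        · exact .inr ⟨i, j, hij, hui, hjv.trans hvw⟩
        · exact .inr ⟨i, l, hij.trans ((hA j k (hjv.trans hvk)).trans hkl), hui, hlw⟩
      antisymm := by
        rintro u v (huv | ⟨i, j, hij, hui, hjv⟩) (hvu | ⟨k, l, hkl, hvk, hlu⟩)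
        · exact le_antisymm huv hvu
        · have := le_antisymm hkl (hA l k (hlu.trans (huv.trans hvk)))
          subst this
          exact le_antisymm huv (hvk.trans hlu)
        · have := le_antisymm hij (hA j i (hjv.trans (hvu.trans hui)))
          subst this
          exact le_antisymm (hui.trans hjv) hvu
        · have hjk := hA j k (hjv.trans hvk)
          have hli := hA l i (hlu.trans hui)
          obtain rfl : i = j := le_antisymm hij (hjk.trans (hkl.trans hli))
          obtain rfl : k = l := le_antisymm hkl (hli.trans hjk)
          exact le_antisymm (hui.trans hjv) (hvk.trans hlu) }
  obtain ⟨s, hs, hRs⟩ := extend_partialOrder R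
  have hsA : ∀ i j, i ≤ j → s (A i) (A j) := fun i j hij =>
    hRs _ _ (.inr ⟨i, j, hij, le_rfl, le_rfl⟩)
  refine ⟨s, ⟨hs.refl, hs.antisymm, hs.trans, hs.total, fun x y hxy => hRs _ _ (.inl hxy)⟩,
    fun i j => ⟨fun hij => ?_, hsA i j⟩⟩
  rcases le_total i j with h | h
  · exact h
  · exact hA i j (hs.antisymm _ _ hij (hsA j i h)).le

theorem Admissible.le_of_le {P : Type*} [PartialOrder P] {d : ℕ} {a : Fin d → P}
    (ha : Admissible a) {i j : Fin d} (hij : a i ≤ a j) : i ≤ j := by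
  rcases le_total i j with h | h
  · exact h
  · rcases ha.2 j i h with h' | h'
    · exact (ha.1 (le_antisymm hij h')).le
    · exact absurd hij h'.2

theorem IsHittingFamily.restrict {P : Type*} [PartialOrder P] {d : ℕ} {F : Set (P → P → Prop)}
    (hF : IsHittingFamily d F) (B : Set P) : IsHittingFamily d (restrictFamily F B) := by
  constructor
  · rintro _ ⟨r, hr, rfl⟩
    have hr := hF.1 r hr
    exact ⟨fun x => hr.refl x, fun x y h₁ h₂ => Subtype.ext (hr.antisymm x y h₁ h₂),
      fun x y z => hr.trans x y z, fun x y => hr.total x y, fun x y => hr.extends_le x y⟩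
  · intro a ha
    obtain ⟨r, hr, hra⟩ := hF.2 (fun i => (a i).1) ⟨Subtype.val_injective.comp ha.1, ha.2⟩
    exact ⟨_, ⟨r, hr, rfl⟩, hra⟩

/-! ### The family of pattern schedules -/

theorem List.IsPrefix.bool_le {x y : List Bool} (hxy : x <+: y) : x ≤ y := by
  induction x generalizing y with
  | nil => exact not_lt.1 List.not_lex_nil
  | cons b x ih =>
    obtain ⟨z, rfl⟩ := hxy
    exact List.cons_le_cons b (ih ⟨z, rfl⟩)

theorem Pattern.isSchedule_schedule {d h : ℕ} (p : Pattern d h) : IsSchedule p.schedule where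
  refl x := .inr ⟨rfl, le_rfl⟩
  antisymm x y := by
    rintro (⟨hne, hxy⟩ | ⟨he, hxy⟩) (⟨hne', hyx⟩ | ⟨he', hyx⟩)
    · exact absurd (p.isSchedule.antisymm _ _ hxy hyx) hne
    · exact absurd he'.symm hne
    · exact absurd he.symm hne'
    · exact Subtype.ext (le_antisymm hxy hyx)
  trans x y z := by
    rintro (⟨hne, hxy⟩ | ⟨he, hxy⟩) (⟨hne', hyz⟩ | ⟨he', hyz⟩)
    · refine .inl ⟨fun he => hne ?_, p.isSchedule.trans _ _ _ hxy hyz⟩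
      exact p.isSchedule.antisymm _ _ hxy (he ▸ hyz)
    · exact .inl ⟨he' ▸ hne, he' ▸ hxy⟩
    · exact .inl ⟨he ▸ hne', he ▸ hyz⟩
    · exact .inr ⟨he.trans he', le_trans hxy hyz⟩
  total x y := by
    by_cases he : p.tree.cell x.1 = p.tree.cell y.1
    · exact (le_total x.1 y.1).imp (fun h => .inr ⟨he, h⟩) fun h => .inr ⟨he.symm, h⟩
    · exact (p.isSchedule.total _ _).imp (fun h => .inl ⟨he, h⟩) fun h => .inl ⟨Ne.symm he, h⟩
  extends_le x y hxy := by
    by_cases he : p.tree.cell x.1 = p.tree.cell y.1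
    · exact .inr ⟨he, List.IsPrefix.bool_le hxy⟩
    · exact .inl ⟨he, p.isSchedule.extends_le _ _ (p.tree.cell_mono hxy)⟩

theorem isHittingFamily_patternFamily {d : ℕ} (hd : 0 < d) (h : ℕ) :
    IsHittingFamily d (patternFamily d h) := by
  classical
  refine ⟨by rintro _ ⟨p, rfl⟩; exact p.isSchedule_schedule, fun a ha => ?_⟩
  have hinj : Function.Injective fun i => (a i).1 := Subtype.val_injective.comp ha.1
  let S : Finset (List Bool) := Finset.univ.image fun i => (a i).1
  have hmem : ∀ i, (a i).1 ∈ S := fun i => Finset.mem_image_of_mem _ (Finset.mem_univ i)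
  have hcard : S.card = d := by simp [S, Finset.card_image_of_injective _ hinj]
  obtain ⟨t, ht⟩ := LayeredTree.exists_separates h h [] S (by simp) ⟨_, hmem ⟨0, hd⟩⟩
    fun x hx => by
      obtain ⟨i, -, rfl⟩ := Finset.mem_image.1 hx
      exact ⟨List.nil_prefix, (a i).2⟩
  have hcell : ∀ i j, t.cell (a i).1 ≤ t.cell (a j).1 → i ≤ j := fun i j hij =>
    ha.le_of_le (ht.prefix_of_cell_le _ (hmem i) _ (hmem j) hij)
  obtain ⟨r, hr, hra⟩ := exists_isSchedule_hits (fun i => t.cell (a i).1) hcell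
  have h₁ := ht.numInner_lt
  have h₂ := ht.card_le
  have h₃ := ht.numNodes_lt
  rw [hcard] at h₁ h₂ h₃
  let p : Pattern d h := ⟨t, h₂, by omega, by omega, ht.layersIn, r, hr⟩
  refine ⟨p.schedule, ⟨p, rfl⟩, fun i j => ?_⟩
  by_cases hij : i = j
  · subst hij
    exact iff_of_true (p.isSchedule_schedule.refl _) le_rfl
  · have hne : t.cell (a i).1 ≠ t.cell (a j).1 := fun he =>
      hij (le_antisymm (hcell i j he.le) (hcell j i he.ge))
    exact ⟨fun hs => hs.elim (fun hs => (hra i j).1 hs.2) fun hs => absurd hs.1 hne,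
      fun hs => .inl ⟨hne, (hra i j).2 hs⟩⟩

/-- Height `0` offers no layer, so the tree would be a single leaf, with fewer than `d` nodes. This
covers the height excluded from the encoding by words. -/
theorem isEmpty_pattern_zero {d : ℕ} (hd : 2 ≤ d) : IsEmpty (Pattern d 0) := by
  refine ⟨fun p => ?_⟩
  have h₁ := p.le_numNodes
  have h₂ := p.layersIn
  cases ht : p.tree with
  | leaf => simp [ht, LayeredTree.numNodes] at h₁; omega
  | unary => rw [ht] at h₂; exact absurd h₂.2.1 (by omega)
  | binary => rw [ht] at h₂; exact absurd h₂.2.1 (by omega)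

theorem finite_patternFamily_and_ncard_le {d : ℕ} {h : ℕ} (hh : 0 < h) :
    (patternFamily d h).Finite ∧
      (patternFamily d h).ncard ≤ 3 ^ (2 * d - 1) * h ^ (d - 1) * (2 * d - 1).factorial := by
  obtain ⟨hfin, hcard⟩ := LayeredTree.finite_bounded_and_ncard_le (2 * d - 1) (d - 1) h hh
  -- The type of `order` depends on the tree, so the family is covered by a union over trees of the
  -- schedules that each tree yields.
  let G : LayeredTree → Set (CBTree h → CBTree h → Prop) := fun t =>
    (fun (r : t.Node → t.Node → Prop) (x y : CBTree h) =>
      (t.cell x.1 ≠ t.cell y.1 ∧ r (t.cell x.1) (t.cell y.1)) ∨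
        (t.cell x.1 = t.cell y.1 ∧ x.1 ≤ y.1)) '' {r | IsSchedule r}
  have hGfin : ∀ t, (G t).Finite := fun t => (finite_setOf_isSchedule _).image _
  have hG : ∀ t ∈ LayeredTree.bounded (2 * d - 1) (d - 1) h,
      (G t).ncard ≤ (2 * d - 1).factorial := fun t ht => by
    refine (Set.ncard_image_le (finite_setOf_isSchedule _)).trans
      ((ncard_setOf_isSchedule_le _).trans (Nat.factorial_le ?_))
    rw [LayeredTree.card_node]
    exact ht.1
  have hsub : patternFamily d h ⊆ ⋃ t ∈ hfin.toFinset, G t := by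
    rintro _ ⟨p, rfl⟩
    refine Set.mem_biUnion (x := p.tree) ?_ ⟨p.order, p.isSchedule, rfl⟩
    exact hfin.mem_toFinset.2 ⟨p.numNodes_le, p.numInner_le, p.layersIn⟩
  have hUfin : (⋃ t ∈ hfin.toFinset, G t).Finite :=
    Set.Finite.biUnion (Finset.finite_toSet _) fun t _ => hGfin t
  refine ⟨hUfin.subset hsub, (Set.ncard_le_ncard hsub hUfin).trans ?_⟩
  refine (Finset.set_ncard_biUnion_le _ _).trans ?_
  refine (Finset.sum_le_card_nsmul _ _ _ fun t ht => hG t (by simpa using ht)).trans ?_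
  rw [smul_eq_mul, ← Set.ncard_eq_toFinset_card _ hfin]
  exact Nat.mul_le_mul_right _ hcard

/-- Used with `N = 2 * d - 1`, where `5` corresponds to `d = 3`; for `d = 2` the inequality fails,
as `27 > 64 / 3`. -/
theorem three_pow_le {N : ℕ} (hN : 5 ≤ N) : (3 : ℝ) ^ N ≤ 4 ^ N / 3 := by
  induction N, hN using Nat.le_induction with
  | base => norm_num
  | succ n _ ih => rw [pow_succ, pow_succ]; linarith [pow_pos (show (0 : ℝ) < 4 by norm_num) n]

theorem patternConst_nonneg (d : ℕ) : 0 ≤ patternConst d := by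
  unfold patternConst; positivity

theorem finite_patternFamily {d : ℕ} (hd : 3 ≤ d) (h : ℕ) : (patternFamily d h).Finite := by
  rcases Nat.eq_zero_or_pos h with rfl | hh
  · have := isEmpty_pattern_zero (d := d) (by omega)
    exact Set.finite_range _
  · exact (finite_patternFamily_and_ncard_le hh).1

theorem ncard_patternFamily_le {d : ℕ} (hd : 3 ≤ d) (h : ℕ) :
    ((patternFamily d h).ncard : ℝ) ≤ patternConst d * (h : ℝ) ^ (d - 1) := by
  rcases Nat.eq_zero_or_pos h with rfl | hh
  · have := isEmpty_pattern_zero (d := d) (by omega)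
    rw [patternFamily, Set.range_eq_empty, Set.ncard_empty, Nat.cast_zero]
    exact mul_nonneg (patternConst_nonneg d) (by positivity)
  · have h₁ : ((patternFamily d h).ncard : ℝ) ≤
        3 ^ (2 * d - 1) * (h : ℝ) ^ (d - 1) * ((2 * d - 1).factorial : ℝ) := by
      exact_mod_cast (finite_patternFamily_and_ncard_le (d := d) hh).2
    have h₂ := three_pow_le (N := 2 * d - 1) (by omega)
    calc _ ≤ _ := h₁
      _ ≤ 4 ^ (2 * d - 1) / 3 * (h : ℝ) ^ (d - 1) * ((2 * d - 1).factorial : ℝ) := by gcongr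
      _ = _ := by unfold patternConst; ring

/-! ### The number of nodes of the complete binary tree -/

/-- A node of the complete binary tree of height `h + 1` is the root, or given by a letter and a
node of the tree of height `h`. -/
def CBTree.succEquiv (h : ℕ) : CBTree (h + 1) ≃ Option (Bool × CBTree h) where
  toFun
    | ⟨[], _⟩ => none
    | ⟨b :: w, hw⟩ => some (b, ⟨w, Nat.le_of_succ_le_succ hw⟩)
  invFun
    | none => ⟨[], Nat.zero_le _⟩
    | some (b, w) => ⟨b :: w.1, Nat.succ_le_succ w.2⟩
  left_inv x := by rcases x with ⟨_ | _, _⟩ <;> rfl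
  right_inv x := by rcases x with _ | _ <;> rfl

theorem CBTree.finite_and_card (h : ℕ) :
    Finite (CBTree h) ∧ Nat.card (CBTree h) = 2 ^ (h + 1) - 1 := by
  induction h with
  | zero =>
    have he : ∀ x : CBTree 0, x = ⟨[], le_rfl⟩ := fun x =>
      Subtype.ext (List.eq_nil_of_length_eq_zero (Nat.le_zero.1 x.2))
    have : Subsingleton (CBTree 0) := ⟨fun x y => (he x).trans (he y).symm⟩
    exact ⟨inferInstance, by simpa using Nat.card_eq_one_iff_exists.2 ⟨_, he⟩⟩
  | succ h ih =>
    obtain ⟨hfin, hcard⟩ := ih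
    refine ⟨Finite.of_equiv _ (CBTree.succEquiv h).symm, ?_⟩
    rw [Nat.card_congr (CBTree.succEquiv h), Finite.card_option, Nat.card_prod, hcard]
    have : 0 < 2 ^ (h + 1) := by positivity
    rw [Nat.card_eq_fintype_card, Fintype.card_bool, pow_succ 2 (h + 1)]
    omega

theorem CBTree.height_le_logb_card (h : ℕ) : (h : ℝ) ≤ Real.logb 2 (Nat.card (CBTree h)) := by
  have h₁ : 2 ^ h ≤ Nat.card (CBTree h) := by
    rw [(CBTree.finite_and_card h).2, pow_succ]
    have : 0 < 2 ^ h := by positivity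
    omega
  have h₂ : (2 : ℝ) ^ (h : ℝ) ≤ Nat.card (CBTree h) := by
    rw [Real.rpow_natCast]; exact_mod_cast h₁
  exact (Real.le_logb_iff_rpow_le (by norm_num) (lt_of_lt_of_le (by positivity) h₂)).2 h₂

theorem mainTheorem1 (d : ℕ) (hd : 3 ≤ d) (h : ℕ) :
    -- the explicit family is a `d`-hitting family of schedules for the complete binary tree
    IsHittingFamily d (patternFamily d h) ∧
    -- its size, in terms of the height `h`
    (patternFamily d h).Finite ∧
    ((patternFamily d h).ncard : ℝ) ≤ patternConst d * (h : ℝ) ^ (d - 1) ∧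
    -- its size, in terms of the number of nodes, which is `2 ^ (h + 1) - 1`
    Nat.card (CBTree h) = 2 ^ (h + 1) - 1 ∧
    ((patternFamily d h).ncard : ℝ) ≤
      patternConst d * Real.logb 2 (Nat.card (CBTree h)) ^ (d - 1) ∧
    -- trees contained in the complete binary tree, in particular balanced binary trees
    ∀ B : Set (CBTree h),
      IsHittingFamily d (restrictFamily (patternFamily d h) B) ∧
      (restrictFamily (patternFamily d h) B).Finite ∧
      ((restrictFamily (patternFamily d h) B).ncard : ℝ) ≤ patternConst d * (h : ℝ) ^ (d - 1) ∧
      ∀ c : ℝ, (h : ℝ) ≤ c * Real.logb 2 B.ncard →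
        ((restrictFamily (patternFamily d h) B).ncard : ℝ) ≤
          patternConst d * (c * Real.logb 2 B.ncard) ^ (d - 1) := by
  have hhit := isHittingFamily_patternFamily (d := d) (by omega) h
  have hfin := finite_patternFamily hd h
  have hcard := ncard_patternFamily_le hd h
  have hmono : ∀ L : ℝ, (h : ℝ) ≤ L →
      patternConst d * (h : ℝ) ^ (d - 1) ≤ patternConst d * L ^ (d - 1) := fun L hL =>
    mul_le_mul_of_nonneg_left (pow_le_pow_left₀ (Nat.cast_nonneg h) hL _) (patternConst_nonneg d)
  refine ⟨hhit, hfin, hcard, (CBTree.finite_and_card h).2,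
    hcard.trans (hmono _ (CBTree.height_le_logb_card h)), fun B => ?_⟩
  -- Restriction is the image under a map, so it cannot increase the number of members.
  have hB : ((restrictFamily (patternFamily d h) B).ncard : ℝ) ≤
      patternConst d * (h : ℝ) ^ (d - 1) :=
    le_trans (by exact_mod_cast Set.ncard_image_le hfin) hcard
  exact ⟨hhit.restrict B, hfin.image _, hB, fun c hc => hB.trans (hmono _ hc)⟩
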